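/- Let $F$ be a field of characteristic $0$ and let $E$ be the Grassmann algebra of the $F$-vector space with basis $e_1,e_2,\dots$; thus $E$ is unital, with basis $1$ and all products $e_{i_1}\cdots e_{i_s}$, $i_1<\cdots<i_s$, $s\ge 1$, and $e_ie_j=-e_je_i$ for all $i,j$. A choice of degrees $\|e_i\|\in\mathbb{Z}$ defines a $\mathbb{Z}$-grading on $E$ by $\|e_{i_1}\cdots e_{i_s}\|=\|e_{i_1}\|+\cdots+\|e_{i_s}\|$ (and $\|1\|=0$). Let $E^{\infty}$ be $E$ with the grading given by $\|e_i\|=0$ for $i$ even and $\|e_i\|=1$ for $i$ odd; for a positive integer $k$ let $E^{k^*}$ be $E$ with the grading given by $\|e_i\|=1$ for $1\le i\le k$ and $\|e_i\|=0$ for $i>k$. Let $F\langle X|\mathbb{Z}\rangle$ be the free unital associative $F$-algebra on a set $X$ of variables, each variable $x$ having a degree $\alpha(x)\in\mathbb{Z}$, with countably infinitely many variables of each degree; it is $\mathbb{Z}$-graded by giving a monomial the sum of the degrees of its variables. For a $\mathbb{Z}$-graded algebra $A=\bigoplus_n A_n$, let $T_{\mathbb{Z}}(A)$ be the ideal of all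 $f\in F\langle X|\mathbb{Z}\rangle$ that vanish under every substitution of the variables $x$ by elements of $A_{\alpha(x)}$. A $T_{\mathbb{Z}}$-ideal is a two-sided ideal of $F\langle X|\mathbb{Z}\rangle$ that is invariant under all degree-preserving algebra endomorphisms, and the $T_{\mathbb{Z}}$-ideal generated by a set is the smallest $T_{\mathbb{Z}}$-ideal containing it. Write $[x_1,x_2]=x_1x_2-x_2x_1$ and $[x_1,x_2,x_3]=[[x_1,x_2],x_3]$. Theorem. (1) $T_{\mathbb{Z}}(E^{\infty})$ is generated, as a $T_{\mathbb{Z}}$-ideal, by the polynomials $x$ with $\alpha(x)<0$ and the polynomials $[x_1,x_2,x_3]$ for every choice of the degrees $\alpha(x_1),\alpha(x_2),\alpha(x_3)\in\mathbb{Z}$. (2) For every positive integer $k$, $T_{\mathbb{Z}}(E^{k^*})$ is generated, as a $T_{\mathbb{Z}}$-ideal, by the polynomials $x$ with $\alpha(x)\notin\{0,1,\dots,k\}$ and the polynomials $[x_1,x_2,x_3]$ for every choice of the degrees $\alpha(x_1),\alpha(x_2),\alpha(x_3)\in\mathbb{Z}$. -/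

import Mathlib

namespace GrassmannZ

noncomputable section

/-! ### The free `ℤ`-graded associative algebra -/

/-- The variables: `(i, j)` is the variable `x_j^i` of degree `i`, so that there are countably
infinitely many variables of every integer degree. -/
abbrev Var : Type := ℤ × ℕ

/-- The degree `α(x)` of a variable `x`. -/
def Var.deg (v : Var) : ℤ := v.1

/-- The free unital associative algebra `F⟨X | ℤ⟩` on the set of graded variables. -/
abbrev FreeGr (F : Type*) [Field F] : Type _ := FreeAlgebra F Var

/-- A variable, as an element of the free algebra. -/
abbrev X (F : Type*) [Field F] (v : Var) : FreeGr F := FreeAlgebra.ι F v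

/-- The homogeneous component of degree `n` of the free algebra: the span of all monomials
(the empty one, `1`, included) whose variables have degrees that sum up to `n`. -/
def freeComponent (F : Type*) [Field F] (n : ℤ) : Submodule F (FreeGr F) :=
  Submodule.span F
    {m | ∃ w : List Var, (w.map Var.deg).sum = n ∧ m = (w.map (X F)).prod}

/-- A `ℤ`-graded endomorphism of the free algebra: a (unital) algebra endomorphism that respects
the grading. -/
def IsGradedEnd {F : Type*} [Field F] (φ : FreeGr F →ₐ[F] FreeGr F) : Prop :=
  ∀ n : ℤ, ∀ f ∈ freeComponent F n, φ f ∈ freeComponent F n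

/-- A `T_ℤ`-ideal: a two-sided ideal that is invariant under all graded endomorphisms. -/
def IsTIdeal {F : Type*} [Field F] (I : TwoSidedIdeal (FreeGr F)) : Prop :=
  ∀ φ : FreeGr F →ₐ[F] FreeGr F, IsGradedEnd φ → ∀ f ∈ I, φ f ∈ I

/-- The `T_ℤ`-ideal generated by a set of polynomials: the intersection of all the `T_ℤ`-ideals
that contain the set. -/
def tIdealSpan {F : Type*} [Field F] (S : Set (FreeGr F)) : TwoSidedIdeal (FreeGr F) :=
  sInf {I | IsTIdeal I ∧ S ⊆ (I : Set (FreeGr F))}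

/-- `f` is a graded polynomial identity of the algebra `A` with homogeneous components `𝒜 n`:
it vanishes whenever every variable is replaced by a homogeneous element of the same degree. -/
def IsGradedIdentity {F : Type*} [Field F] {A : Type*} [Ring A] [Algebra F A]
    (𝒜 : ℤ → Submodule F A) (f : FreeGr F) : Prop :=
  ∀ a : Var → A, (∀ v, a v ∈ 𝒜 v.deg) → FreeAlgebra.lift F a f = 0

/-- `T_ℤ(A)`, the two-sided ideal of all graded polynomial identities of `A`. -/
def gradedIdentities {F : Type*} [Field F] {A : Type*} [Ring A] [Algebra F A]
    (𝒜 : ℤ → Submodule F A) : TwoSidedIdeal (FreeGr F) :=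
  TwoSidedIdeal.mk' {f | IsGradedIdentity 𝒜 f}
    (fun a _ => map_zero (FreeAlgebra.lift F a))
    (fun {f g} hf hg a ha => by rw [map_add, hf a ha, hg a ha, add_zero])
    (fun {f} hf a ha => by rw [map_neg, hf a ha, neg_zero])
    (fun {f g} hg a ha => by rw [map_mul, hg a ha, mul_zero])
    (fun {f g} hf a ha => by rw [map_mul, hf a ha, zero_mul])

theorem mem_gradedIdentities {F : Type*} [Field F] {A : Type*} [Ring A] [Algebra F A]
    (𝒜 : ℤ → Submodule F A) (f : FreeGr F) :
    f ∈ gradedIdentities 𝒜 ↔ IsGradedIdentity 𝒜 f :=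
  TwoSidedIdeal.mem_mk' _ _ _ _ _ _ f

/-! ### The Grassmann algebra and its homogeneous `ℤ`-gradings -/

/-- The Grassmann algebra `E` of the vector space with basis `e_1, e_2, …`. -/
abbrev E (F : Type*) [Field F] : Type _ := ExteriorAlgebra F (ℕ+ →₀ F)

/-- The generator `e_i` of `E`, `i ≥ 1`. -/
def e (F : Type*) [Field F] (i : ℕ+) : E F := ExteriorAlgebra.ι F (Finsupp.single i 1)

/-- The canonical basis element `e_{i_1} ⋯ e_{i_s}` of `E`, where
`S = {i_1 < ⋯ < i_s}`; it is `1` for the empty set. -/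
def basisElem (F : Type*) [Field F] (S : Finset ℕ+) : E F :=
  ((S.sort (· ≤ ·)).map (e F)).prod

/-- The homogeneous components of the `ℤ`-grading of `E` in which `e_i` has degree `η i`: the
component of degree `n` is spanned by the canonical basis elements `e_{i_1} ⋯ e_{i_s}` with
`η i_1 + ⋯ + η i_s = n`. -/
def gradingOf (F : Type*) [Field F] (η : ℕ+ → ℤ) (n : ℤ) : Submodule F (E F) :=
  Submodule.span F {b | ∃ S : Finset ℕ+, ∑ i ∈ S, η i = n ∧ b = basisElem F S}

/-- The grading `E^∞`: `e_i` has degree `0` for even `i` and degree `1` for odd `i`. -/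
def gradingInfty (F : Type*) [Field F] : ℤ → Submodule F (E F) :=
  gradingOf F (fun i => if Even (i : ℕ) then 0 else 1)

/-- The grading `E^{k*}`: `e_1, …, e_k` have degree `1` and all other `e_i` have degree `0`. -/
def gradingStar (F : Type*) [Field F] (k : ℕ) : ℤ → Submodule F (E F) :=
  gradingOf F (fun i => if (i : ℕ) ≤ k then 1 else 0)

/-! ### The generating polynomials -/

/-- The polynomials `x`, where `x` runs over the variables whose degree lies in `D`. -/
def varsWithDegIn (F : Type*) [Field F] (D : Set ℤ) : Set (FreeGr F) :=
  {f | ∃ v : Var, v.deg ∈ D ∧ f = X F v}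

/-- The triple commutators `[x_1, x_2, x_3] = [[x_1, x_2], x_3]` in three distinct variables, one
for every choice `a, b, c` of the degrees of `x_1, x_2, x_3`. -/
def tripleCommutators (F : Type*) [Field F] : Set (FreeGr F) :=
  {f | ∃ a b c : ℤ, f = ⁅⁅X F (a, 1), X F (b, 2)⁆, X F (c, 3)⁆}

end

end GrassmannZ

/-!
Let `I` be the `T_ℤ`-ideal generated by the given polynomials. Both gradings have generators of
degrees `0` and `1` only, infinitely many of degree `0`, and the variables in `I` are those whose
degree `n` satisfies `E_n = 0`; only these properties matter (`gradedIdentities_gradingOf`). That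
`I` consists of identities is a direct check: even words in the generators are central in `E`.

For the converse, all triple commutators vanish in the quotient by `I`, since they are multilinear
and monomials are homogeneous. Hence commutators are central there and `[a, b][c, d] = -[a, c][b, d]`,
so products of commutators are skew-symmetric in all their entries. Reordering letters at the
expense of commutators shows that the quotient is spanned by the elements `x^a [J]`, where `x^a` is
a monomial with its letters in a fixed order, given by a multiset `a`, and `[J]` is the product of
commutators of the variables of a finite set `J` (`IsLieNilpotent.lift_mem_span`).

So an identity `f` is congruent to a combination of elements `x^a [J]`, none of which lies in `I`.
If the combination is not zero, choose a term `(a₀, J₀)` with `(|J₀|, |a₀|)` lexicographically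
minimal. Since `x^{a₀} [J₀]` is not in `I`, its variables have degrees `≥ 0` and its total degree
occurs in `E`. There are therefore words in the generators with disjoint supports, one for each
letter of `a₀`, of even length, and one for each letter of `J₀`, of odd length, having the degrees
of these letters (`exists_disjoint_words`). Substitute for each variable `v` the sum `y_v + z_v`,
where `y_v` is the sum of the even words that belong to `v` and `z_v` is the odd word of `v`, or
`0`. As `y_v` is central, `[J]` becomes `2^{|J|/2}` times the product of the `z_v`, which is zero
unless `J ⊆ J₀`; and `[J₀]` kills every `z_v`, so that `x^a [J₀]` becomes a multiple of the product
of the `y_v` over `a`, which is zero unless `a ≤ a₀` because the words are square-zero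
(`prod_labelSum`). By minimality only the term of `(a₀, J₀)` survives; it is a nonzero multiple of
a product of distinct generators of `E` (`exists_generic_substitution`), a contradiction.
-/

namespace GrassmannZ

/-! ### Skew-symmetric functions on lists -/

/-- A function on lists that changes its sign when two adjacent entries are exchanged. -/
def IsSkew {α M : Type*} [Neg M] (P : List α → M) : Prop :=
  ∀ (p : List α) (a b : α) (q : List α), P (p ++ a :: b :: q) = -P (p ++ b :: a :: q)

theorem IsSkew.perm {α M : Type*} [InvolutiveNeg M] {P : List α → M} (hP : IsSkew P)
    {l l' : List α} (h : l.Perm l') : P l = P l' ∨ P l = -P l' := by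
  suffices H : ∀ p, P (p ++ l) = P (p ++ l') ∨ P (p ++ l) = -P (p ++ l') from H []
  induction h with
  | nil => exact fun p => Or.inl rfl
  | cons x _ ih => exact fun p => by simpa using ih (p ++ [x])
  | swap x y l => exact fun p => Or.inr (hP p y x l)
  | trans _ _ ih₁ ih₂ =>
    intro p
    rcases ih₁ p with h₁ | h₁ <;> rcases ih₂ p with h₂ | h₂ <;> simp [h₁, h₂]

theorem IsSkew.eq_zero_of_not_nodup {α : Type*} (F : Type*) [Field F] [CharZero F]
    {M : Type*} [AddCommGroup M] [Module F M] {P : List α → M} (hP : IsSkew P)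
    {l : List α} (h : ¬ l.Nodup) : P l = 0 := by
  classical
  obtain ⟨a, ha⟩ : ∃ a, List.Duplicate a l := by
    by_contra! H
    exact h (List.nodup_iff_forall_not_duplicate.2 H)
  have hperm : ∃ q, l.Perm (a :: a :: q) := by
    have h2 : [a, a].Sublist l := List.duplicate_iff_sublist.1 ha
    obtain ⟨q, hq⟩ := h2.exists_perm_append
    exact ⟨q, by simpa using hq⟩
  obtain ⟨q, hq⟩ := hperm
  have h0 : P (a :: a :: q) = 0 := by
    have h1 : P (a :: a :: q) = -P (a :: a :: q) := hP [] a a q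
    have h2 : (2 : F) • P (a :: a :: q) = 0 := by
      rw [two_smul]; nth_rewrite 1 [h1]; exact neg_add_cancel _
    exact (smul_eq_zero.1 h2).resolve_left two_ne_zero
  rcases hP.perm hq with h | h <;> simp [h, h0]

/-! ### Products of commutators -/

/-- The product `[x a₁, x a₂] [x a₃, x a₄] ⋯` of commutators along the list `a₁, a₂, …`; by
convention it is `0` on lists of odd length, which makes it skew-symmetric on all lists. -/
def bracketProd {V R : Type*} [Ring R] (x : V → R) : List V → R
  | [] => 1
  | [_] => 0
  | a :: b :: l => ⁅x a, x b⁆ * bracketProd x l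

theorem bracketProd_eq_zero {V R : Type*} [Ring R] (x : V → R) :
    ∀ l : List V, (∃ v ∈ l, x v = 0) → bracketProd x l = 0
  | [], h => by simp at h
  | [_], _ => rfl
  | a :: b :: l, h => by
    rw [bracketProd]
    obtain ⟨v, hv, h0⟩ := h
    rcases List.mem_cons.1 hv with rfl | hv
    · simp [Ring.lie_def, h0]
    rcases List.mem_cons.1 hv with rfl | hv
    · simp [Ring.lie_def, h0]
    rw [bracketProd_eq_zero x l ⟨v, hv, h0⟩, mul_zero]

theorem bracketProd_eq_zero_of_odd {V R : Type*} [Ring R] (x : V → R) :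
    ∀ l : List V, Odd l.length → bracketProd x l = 0
  | [], h => by simp at h
  | [_], _ => rfl
  | a :: b :: l, h => by
    rw [bracketProd, bracketProd_eq_zero_of_odd x l (by grind), mul_zero]

theorem map_bracketProd {V R S : Type*} [Ring R] [Ring S] (φ : R →+* S) (x : V → R) :
    ∀ l : List V, φ (bracketProd x l) = bracketProd (fun v => φ (x v)) l
  | [] => map_one φ
  | [_] => map_zero φ
  | a :: b :: l => by
    simp [bracketProd, Ring.lie_def, map_bracketProd φ x l]

/-- Rings in which the triple commutators vanish, so that all commutators are central. -/
def IsLieNilpotent (R : Type*) [Ring R] : Prop :=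
  ∀ a b c : R, ⁅⁅a, b⁆, c⁆ = 0

theorem IsLieNilpotent.comm {R : Type*} [Ring R] (hR : IsLieNilpotent R) (a b c : R) :
    ⁅a, b⁆ * c = c * ⁅a, b⁆ := by
  have := hR a b c
  rwa [Ring.lie_def ⁅a, b⁆, sub_eq_zero] at this

/-- Exchanging the two inner entries of a product of two commutators changes its sign: expand
`[[a, b c], d] = 0`. -/
theorem IsLieNilpotent.lie_mul_lie {R : Type*} [Ring R] (hR : IsLieNilpotent R) (a b c d : R) :
    ⁅a, b⁆ * ⁅c, d⁆ = -(⁅a, c⁆ * ⁅b, d⁆) := by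
  have h : ⁅⁅a, b * c⁆, d⁆ = ⁅a, b⁆ * ⁅c, d⁆ + ⁅⁅a, b⁆, d⁆ * c + b * ⁅⁅a, c⁆, d⁆ + ⁅b, d⁆ * ⁅a, c⁆ := by
    simp only [Ring.lie_def]; noncomm_ring
  rw [hR, hR, hR, zero_mul, mul_zero, add_zero, add_zero, hR.comm b d] at h
  exact eq_neg_of_add_eq_zero_left h.symm

theorem IsLieNilpotent.isSkew_bracketProd {V R : Type*} [Ring R] (hR : IsLieNilpotent R)
    (x : V → R) : IsSkew (bracketProd x)
  | [], a, b, q => by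
    simp only [List.nil_append, bracketProd]
    rw [← neg_mul, Ring.lie_def, Ring.lie_def, neg_sub]
  | [p], a, b, [] => by simp [bracketProd]
  | [p], a, b, c :: q => by
    simp only [List.cons_append, List.nil_append, bracketProd]
    rw [← mul_assoc, hR.lie_mul_lie, ← mul_assoc, neg_mul]
  | p :: p' :: ps, a, b, q => by
    simp only [List.cons_append, bracketProd]
    rw [hR.isSkew_bracketProd x ps a b q, mul_neg]

/-! ### A spanning set for algebras with central commutators -/

/-- The element `x_{v₁} ⋯ x_{vₙ} · [x_{w₁}, x_{w₂}] [x_{w₃}, x_{w₄}] ⋯` attached to the multiset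
`{v₁, …, vₙ}` and the set `{w₁, w₂, …}`, both listed in some fixed order. -/
noncomputable def normalElem {V R : Type*} [Ring R] (x : V → R) (p : Multiset V × Finset V) : R :=
  (p.1.toList.map x).prod * bracketProd x p.2.toList

theorem map_normalElem {V R S : Type*} [Ring R] [Ring S] (φ : R →+* S) (x : V → R)
    (p : Multiset V × Finset V) : φ (normalElem x p) = normalElem (fun v => φ (x v)) p := by
  simp [normalElem, map_bracketProd, map_list_prod, Function.comp_def]

/-- Reordering a word costs words that are shorter by two letters, with one more commutator; so
an induction on the length of the word applies. -/
theorem IsLieNilpotent.word_mul_bracketProd_mem_span {F V R : Type*} [Field F] [CharZero F]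
    [Ring R] [Algebra F R] (hR : IsLieNilpotent R) (x : V → R) (w l : List V) :
    (w.map x).prod * bracketProd x l ∈ Submodule.span F (Set.range (normalElem x)) := by
  classical
  set M := Submodule.span F (Set.range (normalElem x)) with hM
  induction hn : w.length using Nat.strong_induction_on generalizing w l with
  | _ n ih =>
  -- membership does not depend on the order of the letters, whatever prefix `p` precedes them
  have hperm : ∀ {u u' : List V}, u.Perm u' → ∀ p : List V, (p ++ u).length = n →
      ((((p ++ u).map x).prod * bracketProd x l ∈ M) ↔
        (((p ++ u').map x).prod * bracketProd x l ∈ M)) := by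
    intro u u' h
    induction h with
    | nil => exact fun p _ => Iff.rfl
    | cons a _ ih => exact fun p hp => by simpa using ih (p ++ [a]) (by simpa using hp)
    | swap a b q =>
      intro p hp
      have key : ((p ++ b :: a :: q).map x).prod * bracketProd x l =
          ((p ++ a :: b :: q).map x).prod * bracketProd x l +
            ((p ++ q).map x).prod * bracketProd x (b :: a :: l) := by
        have hc := hR.comm (x b) (x a) (q.map x).prod
        simp only [List.map_append, List.map_cons, List.prod_append, List.prod_cons, bracketProd]
        rw [mul_assoc _ (q.map x).prod, ← mul_assoc (q.map x).prod, ← hc]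
        simp only [Ring.lie_def]
        noncomm_ring
      rw [key]
      exact M.add_mem_iff_left (ih _ (by simp at hp ⊢; omega) _ _ rfl)
    | trans h₁ _ ih₁ ih₂ =>
      intro p hp
      exact (ih₁ p hp).trans (ih₂ p (by rw [← hp]; simp [h₁.length_eq]))
  have hw : w.Perm (w : Multiset V).toList := by
    rw [← Multiset.coe_eq_coe, Multiset.coe_toList]
  have := (hperm hw [] (by simpa using hn)).2
  simp only [List.nil_append] at this
  apply this
  have hsk := hR.isSkew_bracketProd x
  by_cases hl : l.Nodup
  · have hlp : l.Perm l.toFinset.toList :=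
      ((List.toFinset_toList hl)).symm
    have hmem : normalElem x ((w : Multiset V), l.toFinset) ∈ M :=
      Submodule.subset_span ⟨_, rfl⟩
    rcases hsk.perm hlp with h | h
    · rw [h]; exact hmem
    · rw [h, mul_neg]; exact M.neg_mem hmem
  · rw [hsk.eq_zero_of_not_nodup F hl, mul_zero]; exact M.zero_mem

theorem mem_span_words {F V : Type*} [Field F] (f : FreeAlgebra F V) :
    f ∈ Submodule.span F (Set.range fun w : List V => (w.map (FreeAlgebra.ι F)).prod) := by
  induction f using FreeAlgebra.induction with
  | grade0 r =>
    rw [Algebra.algebraMap_eq_smul_one]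
    exact Submodule.smul_mem _ _ (Submodule.subset_span ⟨[], by simp⟩)
  | grade1 v => exact Submodule.subset_span ⟨[v], by simp⟩
  | mul a b ha hb =>
    have := Submodule.mul_mem_mul ha hb
    rw [Submodule.span_mul_span] at this
    refine Submodule.span_mono ?_ this
    rintro _ ⟨_, ⟨u, rfl⟩, _, ⟨v, rfl⟩, rfl⟩
    exact ⟨u ++ v, by simp⟩
  | add a b ha hb => exact Submodule.add_mem _ ha hb

theorem IsLieNilpotent.lift_mem_span {F V R : Type*} [Field F] [CharZero F]
    [Ring R] [Algebra F R] (hR : IsLieNilpotent R) (x : V → R) (f : FreeAlgebra F V) :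
    FreeAlgebra.lift F x f ∈ Submodule.span F (Set.range (normalElem x)) := by
  have hf := mem_span_words f
  induction hf using Submodule.span_induction with
  | mem f hf =>
    obtain ⟨w, rfl⟩ := hf
    simpa [map_list_prod, Function.comp_def, bracketProd] using
      hR.word_mul_bracketProd_mem_span (F := F) x w []
  | zero => simp
  | add f g _ _ hf hg => rw [map_add]; exact Submodule.add_mem _ hf hg
  | smul c f _ hf => rw [map_smul]; exact Submodule.smul_mem _ _ hf

/-! ### Commutative square-zero elements -/

theorem multiset_prod_map_add_ite {V C : Type*} [DecidableEq V] [CommRing C] (y : V → C) (v : V)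
    (ε : C) (hε : ε * ε = 0) (a : Multiset V) :
    (a.map fun w => y w + if w = v then ε else 0).prod =
      (a.map y).prod + a.count v • (ε * ((a.erase v).map y).prod) := by
  induction a using Multiset.induction_on with
  | empty => simp
  | cons w a ih =>
    rw [Multiset.map_cons, Multiset.prod_cons, ih, Multiset.map_cons, Multiset.prod_cons]
    by_cases h : w = v
    · subst h
      rw [if_pos rfl, Multiset.count_cons_self, Multiset.erase_cons_head]
      by_cases hw : w ∈ a
      · have h2 := congrArg (fun s => (Multiset.map y s).prod) (Multiset.cons_erase hw)
        simp only [Multiset.map_cons, Multiset.prod_cons] at h2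
        rw [← h2]
        simp only [nsmul_eq_mul]
        push_cast
        linear_combination (Multiset.count w a : C) * (Multiset.map y (a.erase w)).prod * hε
      · simp [Multiset.count_eq_zero_of_notMem hw]; ring
    · rw [if_neg h, Multiset.count_cons_of_ne (Ne.symm h), Multiset.erase_cons_tail _ h,
        Multiset.map_cons, Multiset.prod_cons]
      simp only [nsmul_eq_mul]
      ring

/-- The sum of the entries with label `v` in a list of labelled elements. -/
def labelSum {V C : Type*} [DecidableEq V] [AddCommMonoid C] (A : List (V × C)) (v : V) : C :=
  (A.map fun s => if v = s.1 then s.2 else 0).sum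

/-- A product of label sums of square-zero elements vanishes when some label is used more often
than it occurs in `A`, and is a positive multiple of the product of all elements when each label
is used as often as it occurs. -/
theorem prod_labelSum {V C : Type*} [DecidableEq V] [CommRing C] (A : List (V × C))
    (hA : ∀ s ∈ A, s.2 * s.2 = 0) :
    (∀ a : Multiset V, ¬ a ≤ (A.map Prod.fst : Multiset V) → (a.map (labelSum A)).prod = 0) ∧
      ∃ n : ℕ, n ≠ 0 ∧
        ((A.map Prod.fst : Multiset V).map (labelSum A)).prod = n • (A.map Prod.snd).prod := by
  induction A with
  | nil =>
    refine ⟨fun a ha => ?_, 1, one_ne_zero, by simp⟩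
    obtain ⟨v, hv⟩ := Multiset.exists_mem_of_ne_zero (s := a) (by rintro rfl; simp at ha)
    exact Multiset.prod_eq_zero (Multiset.mem_map.2 ⟨v, hv, by simp [labelSum]⟩)
  | cons s A ih =>
    obtain ⟨ih0, n, hn, ihn⟩ := ih fun t ht => hA t (List.mem_cons_of_mem _ ht)
    have hs : s.2 * s.2 = 0 := hA s List.mem_cons_self
    have hL : labelSum (s :: A) = fun w => labelSum A w + if w = s.1 then s.2 else 0 := by
      funext w; simp [labelSum, add_comm]
    simp only [hL, List.map_cons]
    refine ⟨fun a ha => ?_, n * (Multiset.count s.1 (A.map Prod.fst : Multiset V) + 1),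
      by positivity, ?_⟩
    · rw [multiset_prod_map_add_ite _ _ _ hs, ih0 a, zero_add]
      · by_cases hv : s.1 ∈ a
        · rw [ih0 (a.erase s.1), mul_zero, smul_zero]
          rw [Multiset.erase_le_iff_le_cons]
          simpa using ha
        · rw [Multiset.count_eq_zero_of_notMem hv, zero_smul]
      · intro h
        apply ha
        rw [← Multiset.cons_coe]
        exact h.trans (Multiset.le_cons_self _ _)
    · rw [multiset_prod_map_add_ite _ _ _ hs, ← Multiset.cons_coe, ih0, zero_add,
        Multiset.erase_cons_head, ihn, Multiset.count_cons_self, List.prod_cons]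
      · simp only [nsmul_eq_mul]; push_cast; ring
      · intro h
        have := Multiset.card_le_card h
        simp at this

/-! ### Words in the generators of the Grassmann algebra -/

variable {F : Type*} [Field F]

theorem e_mul_e (i j : ℕ+) : e F i * e F j = -(e F j * e F i) :=
  eq_neg_of_add_eq_zero_left (ExteriorAlgebra.ι_add_mul_swap _ _)

/-- The product of the generators along a list of indices. -/
noncomputable def eWord (F : Type*) [Field F] (l : List ℕ+) : E F := (l.map (e F)).prod

theorem eWord_append (l l' : List ℕ+) : eWord F (l ++ l') = eWord F l * eWord F l' := by
  simp [eWord]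

theorem eWord_flatten (ls : List (List ℕ+)) :
    eWord F ls.flatten = (ls.map (eWord F)).prod := by
  induction ls with
  | nil => simp [eWord]
  | cons l ls ih => simp [eWord_append, ih]

theorem isSkew_eWord : IsSkew (eWord F) := by
  intro p a b q
  simp only [eWord, List.map_append, List.map_cons, List.prod_append, List.prod_cons]
  rw [← mul_assoc (e F a), e_mul_e, neg_mul, mul_neg, mul_assoc]

theorem eWord_mul_ι (l : List ℕ+) (m : ℕ+ →₀ F) :
    eWord F l * ExteriorAlgebra.ι F m = (-1) ^ l.length * (ExteriorAlgebra.ι F m * eWord F l) := by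
  induction l with
  | nil => simp [eWord]
  | cons i l ih =>
    have h : e F i * ExteriorAlgebra.ι F m = -(ExteriorAlgebra.ι F m * e F i) :=
      eq_neg_of_add_eq_zero_left (ExteriorAlgebra.ι_add_mul_swap _ _)
    have hc : e F i * (-1) ^ l.length = (-1) ^ l.length * e F i :=
      ((Commute.neg_one_right _).pow_right _).eq
    have hw : eWord F (i :: l) = e F i * eWord F l := by simp [eWord]
    rw [hw, mul_assoc, ih, ← mul_assoc, hc, mul_assoc, ← mul_assoc (e F i), h, List.length_cons,
      pow_succ]
    simp [mul_assoc]

theorem eWord_mul_eWord (l l' : List ℕ+) :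
    eWord F l * eWord F l' = (-1) ^ (l.length * l'.length) * (eWord F l' * eWord F l) := by
  induction l' with
  | nil => simp [eWord]
  | cons i l' ih =>
    have hw : eWord F (i :: l') = e F i * eWord F l' := by simp [eWord]
    have hc : e F i * (-1) ^ (l.length * l'.length) = (-1) ^ (l.length * l'.length) * e F i :=
      ((Commute.neg_one_right _).pow_right _).eq
    rw [hw, ← mul_assoc, e, eWord_mul_ι, mul_assoc, mul_assoc, ih, ← e, ← mul_assoc (e F i), hc,
      List.length_cons, mul_add, mul_one, add_comm, pow_add]
    simp only [mul_assoc]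

theorem eWord_mem_center {l : List ℕ+} (hl : Even l.length) :
    eWord F l ∈ Subalgebra.center F (E F) := by
  rw [Subalgebra.mem_center_iff]
  intro b
  induction b using ExteriorAlgebra.induction with
  | algebraMap r => exact Algebra.commutes _ _
  | ι m => rw [eWord_mul_ι, hl.neg_one_pow, one_mul]
  | mul a b ha hb => rw [mul_assoc, hb, ← mul_assoc, ha, mul_assoc]
  | add a b ha hb => rw [add_mul, mul_add, ha, hb]

theorem lie_eWord_mem_center (l l' : List ℕ+) :
    ⁅eWord F l, eWord F l'⁆ ∈ Subalgebra.center F (E F) := by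
  rw [Ring.lie_def]
  by_cases h : Even (l.length * l'.length)
  · rw [eWord_mul_eWord, h.neg_one_pow, one_mul, sub_self]
    exact zero_mem _
  · have h' : Even (l ++ l').length ∧ Even (l' ++ l).length := by
      simp only [List.length_append]
      grind
    rw [← eWord_append, ← eWord_append]
    exact sub_mem (eWord_mem_center h'.1) (eWord_mem_center h'.2)

theorem eWord_ne_zero {l : List ℕ+} (hl : l.Nodup) : eWord F l ≠ 0 := by
  -- the determinant of the coordinates at the entries of `l` takes the value `1` on the word
  let g : (ℕ+ →₀ F) →ₗ[F] (Fin l.length → F) := LinearMap.pi fun j => Finsupp.lapply (l.get j)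
  let φ : ∀ i, (ℕ+ →₀ F) [⋀^Fin i]→ₗ[F] F := fun i =>
    if h : i = l.length then
      (Matrix.detRowAlternating.compLinearMap g).domDomCongr (finCongr h.symm)
    else 0
  have hw : eWord F l = ExteriorAlgebra.ιMulti F l.length
      (fun i => Finsupp.single (l.get i) (1 : F)) := by
    rw [ExteriorAlgebra.ιMulti_apply, eWord]
    congr 1
    apply List.ext_get <;> simp [e]
  intro h0
  have h1 : ExteriorAlgebra.liftAlternating φ (eWord F l) = 1 := by
    rw [hw, ExteriorAlgebra.liftAlternating_apply_ιMulti]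
    have : φ l.length = Matrix.detRowAlternating.compLinearMap g := by
      simp only [φ, dif_pos]
      rfl
    rw [this, AlternatingMap.compLinearMap_apply]
    have h2 : (fun i => g (Finsupp.single (l.get i) 1)) = (1 : Matrix _ _ F) := by
      ext i j
      simp [g, Finsupp.single_apply, Matrix.one_apply, hl.getElem_inj_iff,
        Fin.ext_iff]
    change Matrix.det (fun i => g (Finsupp.single (l.get i) 1)) = 1
    rw [h2, Matrix.det_one]
  rw [h0, map_zero] at h1
  exact zero_ne_one h1

/-! ### The gradings of the Grassmann algebra -/

theorem eWord_mem_gradingOf [CharZero F] (η : ℕ+ → ℤ) (l : List ℕ+) :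
    eWord F l ∈ gradingOf F η (l.map η).sum := by
  by_cases hl : l.Nodup
  · have hperm : l.Perm (l.toFinset.sort (· ≤ ·)) := by
      rw [← Multiset.coe_eq_coe, Finset.sort_eq, List.toFinset_val, hl.dedup]
    have hmem : eWord F (l.toFinset.sort (· ≤ ·)) ∈ gradingOf F η (l.map η).sum :=
      Submodule.subset_span ⟨l.toFinset, List.sum_toFinset η hl, rfl⟩
    rcases isSkew_eWord.perm (P := eWord F) hperm with h | h
    · rwa [h]
    · rw [h]; exact neg_mem hmem
  · rw [isSkew_eWord.eq_zero_of_not_nodup F hl]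
    exact zero_mem _

theorem gradingOf_mul_mem [CharZero F] (η : ℕ+ → ℤ) {m n : ℤ} {a b : E F}
    (ha : a ∈ gradingOf F η m) (hb : b ∈ gradingOf F η n) : a * b ∈ gradingOf F η (m + n) := by
  have h := Submodule.mul_mem_mul ha hb
  rw [gradingOf, gradingOf, Submodule.span_mul_span] at h
  refine Submodule.span_le.2 ?_ h
  rintro _ ⟨_, ⟨S, rfl, rfl⟩, _, ⟨T, rfl, rfl⟩, rfl⟩
  have := eWord_mem_gradingOf (F := F) η (S.sort (· ≤ ·) ++ T.sort (· ≤ ·))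
  rw [eWord_append, List.map_append, List.sum_append] at this
  have hs : ∀ S : Finset ℕ+, ((S.sort (· ≤ ·)).map η).sum = ∑ i ∈ S, η i := by
    intro S
    rw [← Multiset.sum_coe, ← Multiset.map_coe, Finset.sort_eq, Finset.sum]
  rw [hs, hs] at this
  exact this

theorem gradingOf_le_span_eWord (η : ℕ+ → ℤ) (n : ℤ) :
    gradingOf F η n ≤ Submodule.span F (Set.range (eWord F)) :=
  Submodule.span_mono (by rintro _ ⟨S, -, rfl⟩; exact ⟨_, rfl⟩)

theorem lie_lie_eq_zero_of_mem_span {A : Type*} [Ring A] [Algebra F A] {S : Set A}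
    (hS : ∀ a ∈ S, ∀ b ∈ S, ∀ c ∈ S, ⁅⁅a, b⁆, c⁆ = 0) {a b c : A} (ha : a ∈ Submodule.span F S)
    (hb : b ∈ Submodule.span F S) (hc : c ∈ Submodule.span F S) : ⁅⁅a, b⁆, c⁆ = 0 := by
  -- the Lie structure of an associative algebra is not a global instance
  let : LieRing A := LieRing.ofAssociativeRing
  let : LieAlgebra F A := LieAlgebra.ofAssociativeAlgebra
  induction ha using Submodule.span_induction with
  | mem a ha =>
    induction hb using Submodule.span_induction with
    | mem b hb =>
      induction hc using Submodule.span_induction with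
      | mem c hc => exact hS a ha b hb c hc
      | zero => exact lie_zero _
      | add c c' _ _ h h' => rw [lie_add, h, h', add_zero]
      | smul r c _ h => rw [lie_smul, h, smul_zero]
    | zero => rw [lie_zero, zero_lie]
    | add b b' _ _ h h' => rw [lie_add, add_lie, h, h', add_zero]
    | smul r b _ h => rw [lie_smul, smul_lie, h, smul_zero]
  | zero => rw [zero_lie, zero_lie]
  | add a a' _ _ h h' => rw [add_lie, add_lie, h, h', add_zero]
  | smul r a _ h => rw [smul_lie, smul_lie, h, smul_zero]

theorem lie_lie_eq_zero_of_mem_gradingOf (η : ℕ+ → ℤ) {i j k : ℤ} {a b c : E F}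
    (ha : a ∈ gradingOf F η i) (hb : b ∈ gradingOf F η j) (hc : c ∈ gradingOf F η k) :
    ⁅⁅a, b⁆, c⁆ = 0 := by
  refine lie_lie_eq_zero_of_mem_span (S := Set.range (eWord F)) ?_
    (gradingOf_le_span_eWord η i ha) (gradingOf_le_span_eWord η j hb)
    (gradingOf_le_span_eWord η k hc)
  rintro _ ⟨l, rfl⟩ _ ⟨l', rfl⟩ _ ⟨l'', rfl⟩
  rw [Ring.lie_def _ (eWord F l''), sub_eq_zero,
    Subalgebra.mem_center_iff.1 (lie_eWord_mem_center l l') (eWord F l'')]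

/-! ### Graded substitutions and `T_ℤ`-ideals -/

theorem word_mem_freeComponent (w : List Var) :
    (w.map (X F)).prod ∈ freeComponent F (w.map Var.deg).sum :=
  Submodule.subset_span ⟨w, rfl, rfl⟩

theorem one_mem_freeComponent : (1 : FreeGr F) ∈ freeComponent F 0 := by
  simpa using word_mem_freeComponent (F := F) []

theorem X_mem_freeComponent (v : Var) : X F v ∈ freeComponent F v.deg := by
  simpa using word_mem_freeComponent (F := F) [v]

theorem freeComponent_mul_mem {m n : ℤ} {f g : FreeGr F} (hf : f ∈ freeComponent F m)
    (hg : g ∈ freeComponent F n) : f * g ∈ freeComponent F (m + n) := by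
  have h := Submodule.mul_mem_mul hf hg
  rw [freeComponent, freeComponent, Submodule.span_mul_span] at h
  refine Submodule.span_mono ?_ h
  rintro _ ⟨_, ⟨u, rfl, rfl⟩, _, ⟨v, rfl, rfl⟩, rfl⟩
  exact ⟨u ++ v, by simp, by simp⟩

/-- A substitution that respects the degrees of the variables respects the grading. -/
theorem lift_mem_of_mem_freeComponent {A : Type*} [Ring A] [Algebra F A] {𝒜 : ℤ → Submodule F A}
    (h1 : (1 : A) ∈ 𝒜 0) (hmul : ∀ {m n : ℤ} {a b : A}, a ∈ 𝒜 m → b ∈ 𝒜 n → a * b ∈ 𝒜 (m + n))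
    {a : Var → A} (ha : ∀ v, a v ∈ 𝒜 v.deg) {n : ℤ} {f : FreeGr F} (hf : f ∈ freeComponent F n) :
    FreeAlgebra.lift F a f ∈ 𝒜 n := by
  have hw : ∀ w : List Var, (w.map a).prod ∈ 𝒜 (w.map Var.deg).sum := by
    intro w
    induction w with
    | nil => simpa using h1
    | cons v w ih => simpa using hmul (ha v) ih
  induction hf using Submodule.span_induction with
  | mem f hf =>
    obtain ⟨w, rfl, rfl⟩ := hf
    simpa [map_list_prod, Function.comp_def] using hw w
  | zero => simp
  | add f g _ _ hf hg => rw [map_add]; exact add_mem hf hg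
  | smul c f _ hf => rw [map_smul]; exact Submodule.smul_mem _ c hf

theorem isGradedEnd_lift {u : Var → FreeGr F} (hu : ∀ v, u v ∈ freeComponent F v.deg) :
    IsGradedEnd (FreeAlgebra.lift F u) := fun _ _ hf =>
  lift_mem_of_mem_freeComponent one_mem_freeComponent freeComponent_mul_mem hu hf

theorem bracketProd_mem_freeComponent :
    ∀ l : List Var, bracketProd (X F) l ∈ freeComponent F (l.map Var.deg).sum
  | [] => by simpa [bracketProd] using one_mem_freeComponent (F := F)
  | [_] => zero_mem _
  | a :: b :: l => by
    have ha := X_mem_freeComponent (F := F) a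
    have hb := X_mem_freeComponent (F := F) b
    have hab : ⁅X F a, X F b⁆ ∈ freeComponent F (a.deg + b.deg) := by
      rw [Ring.lie_def]
      refine sub_mem (freeComponent_mul_mem ha hb) ?_
      rw [add_comm a.deg]
      exact freeComponent_mul_mem hb ha
    have := freeComponent_mul_mem hab (bracketProd_mem_freeComponent l)
    simpa [bracketProd, add_assoc] using this

theorem normalElem_mem_freeComponent (p : Multiset Var × Finset Var) :
    normalElem (X F) p ∈
      freeComponent F ((p.1.toList.map Var.deg).sum + (p.2.toList.map Var.deg).sum) :=
  freeComponent_mul_mem (word_mem_freeComponent _) (bracketProd_mem_freeComponent _)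

theorem one_mem_gradingOf (η : ℕ+ → ℤ) : (1 : E F) ∈ gradingOf F η 0 :=
  Submodule.subset_span ⟨∅, by simp, by simp [basisElem]⟩

theorem isTIdeal_gradedIdentities [CharZero F] (η : ℕ+ → ℤ) :
    IsTIdeal (gradedIdentities (gradingOf F η)) := by
  intro φ hφ f hf
  rw [mem_gradedIdentities] at hf ⊢
  intro a ha
  have hcomp : (FreeAlgebra.lift F a).comp φ =
      FreeAlgebra.lift F fun v => FreeAlgebra.lift F a (φ (X F v)) := by
    apply FreeAlgebra.hom_ext
    funext v
    simp only [Function.comp_apply, AlgHom.comp_apply, FreeAlgebra.lift_ι_apply]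
  have h0 := hf (fun v => FreeAlgebra.lift F a (φ (X F v))) fun v =>
    lift_mem_of_mem_freeComponent (𝒜 := gradingOf F η) (one_mem_gradingOf η)
      (gradingOf_mul_mem η) ha (hφ _ _ (X_mem_freeComponent v))
  rw [← hcomp] at h0
  exact h0

theorem isTIdeal_tIdealSpan (S : Set (FreeGr F)) : IsTIdeal (tIdealSpan S) := by
  intro φ hφ f hf
  rw [tIdealSpan, TwoSidedIdeal.mem_sInf] at hf ⊢
  exact fun I hI => hI.1 φ hφ f (hf I hI)

theorem subset_tIdealSpan (S : Set (FreeGr F)) : S ⊆ (tIdealSpan S : Set (FreeGr F)) := by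
  intro f hf
  rw [SetLike.mem_coe, tIdealSpan, TwoSidedIdeal.mem_sInf]
  exact fun I hI => hI.2 hf

theorem tIdealSpan_le {S : Set (FreeGr F)} {I : TwoSidedIdeal (FreeGr F)} (hI : IsTIdeal I)
    (hS : S ⊆ (I : Set (FreeGr F))) : tIdealSpan S ≤ I :=
  sInf_le ⟨hI, hS⟩

theorem IsTIdeal.mem_of_mem_freeComponent {I : TwoSidedIdeal (FreeGr F)} (hI : IsTIdeal I)
    {v : Var} (hv : X F v ∈ I) {f : FreeGr F} (hf : f ∈ freeComponent F v.deg) : f ∈ I := by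
  classical
  have := hI (FreeAlgebra.lift F (Function.update (X F) v f)) (isGradedEnd_lift fun w => by
    rcases eq_or_ne w v with rfl | h
    · simpa using hf
    · simpa [h] using X_mem_freeComponent w) _ hv
  simpa using this

/-- Three monomials are the images of three distinct variables of the right degrees under one
graded endomorphism, and monomials span. -/
theorem IsTIdeal.isLieNilpotent_quotient {I : TwoSidedIdeal (FreeGr F)} (hI : IsTIdeal I)
    (hT : tripleCommutators F ⊆ (I : Set (FreeGr F))) : IsLieNilpotent I.ringCon.Quotient := by
  let π : FreeGr F →ₐ[F] I.ringCon.Quotient := I.ringCon.mkₐ (α := F)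
  have hπ : ∀ f, π f = 0 ↔ f ∈ I := fun f => by
    rw [TwoSidedIdeal.mem_iff, ← RingCon.eq]; rfl
  have hspan : ∀ a, a ∈ Submodule.span F (Set.range fun w : List Var => π (w.map (X F)).prod) := by
    intro a
    obtain ⟨f, rfl⟩ := RingCon.mkₐ_surjective (α := F) I.ringCon a
    have := Submodule.mem_map_of_mem (f := π.toLinearMap) (mem_span_words f)
    rwa [Submodule.map_span, ← Set.range_comp] at this
  intro a b c
  refine lie_lie_eq_zero_of_mem_span ?_ (hspan a) (hspan b) (hspan c)
  rintro _ ⟨u, rfl⟩ _ ⟨v, rfl⟩ _ ⟨w, rfl⟩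
  let x₁ : Var := ((u.map Var.deg).sum, 1)
  let x₂ : Var := ((v.map Var.deg).sum, 2)
  let x₃ : Var := ((w.map Var.deg).sum, 3)
  let s : Var → FreeGr F := fun y =>
    if y = x₁ then (u.map (X F)).prod else if y = x₂ then (v.map (X F)).prod
    else if y = x₃ then (w.map (X F)).prod else X F y
  have hs : ∀ y, s y ∈ freeComponent F y.deg := by
    intro y
    simp only [s]
    split_ifs with h₁ h₂ h₃
    · rw [h₁]; exact word_mem_freeComponent u
    · rw [h₂]; exact word_mem_freeComponent v
    · rw [h₃]; exact word_mem_freeComponent w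
    · exact X_mem_freeComponent y
  have h₁ : s x₁ = (u.map (X F)).prod := by simp [s]
  have h₂ : s x₂ = (v.map (X F)).prod := by simp [s, x₁, x₂]
  have h₃ : s x₃ = (w.map (X F)).prod := by simp [s, x₁, x₂, x₃]
  have hmem := hI _ (isGradedEnd_lift hs) _ (hT ⟨_, _, _, rfl⟩ :
    ⁅⁅X F x₁, X F x₂⁆, X F x₃⁆ ∈ I)
  rw [← hπ] at hmem
  simpa only [Ring.lie_def, map_sub, map_mul, FreeAlgebra.lift_ι_apply, h₁, h₂, h₃] using hmem

/-! ### A generic substitution -/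

/-- Words with disjoint supports, of prescribed degrees and prescribed parities of their lengths:
each takes its letters of degree `1` from `O` and one or two letters of degree `0`. An entry
`(v, q)` of `L` asks for a word of the degree of `v` whose length is congruent to `q` modulo `2`. -/
theorem exists_disjoint_words {η : ℕ+ → ℤ} (hinf : {i | η i = 0}.Infinite) (L : List (Var × ℕ))
    (hL : ∀ s ∈ L, 0 ≤ s.1.deg) (O : List ℕ+) (hO : O.Nodup) (hη : ∀ i ∈ O, η i = 1)
    (hlen : (O.length : ℤ) = (L.map fun s => s.1.deg).sum) :
    ∃ A : List ((Var × ℕ) × List ℕ+), A.map Prod.fst = L ∧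
      (∀ s ∈ A, (s.2.map η).sum = s.1.1.deg ∧ s.2.length % 2 = s.1.2 % 2 ∧ s.2 ≠ []) ∧
      (A.map Prod.snd).flatten.Nodup ∧ ∀ i ∈ (A.map Prod.snd).flatten, i ∈ O ∨ η i = 0 := by
  induction L generalizing O with
  | nil => exact ⟨[], by simp⟩
  | cons s L ih =>
    obtain ⟨d, hd⟩ := Int.eq_ofNat_of_zero_le (hL s List.mem_cons_self)
    have hnn : 0 ≤ (L.map fun s => s.1.deg).sum := by
      refine List.sum_nonneg fun n hn => ?_
      obtain ⟨t, ht, rfl⟩ := List.mem_map.1 hn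
      exact hL t (List.mem_cons_of_mem _ ht)
    rw [List.map_cons, List.sum_cons, hd] at hlen
    obtain ⟨A, hA, hAs, hAn, hAO⟩ := ih (fun t ht => hL t (List.mem_cons_of_mem _ ht)) (O.drop d)
      (hO.sublist (List.drop_sublist _ _)) (fun i hi => hη i (List.mem_of_mem_drop hi))
      (by rw [List.length_drop]; omega)
    obtain ⟨p, hp0, hp⟩ : ∃ p, p ≠ 0 ∧ (d + p) % 2 = s.2 % 2 := by
      by_cases h : (d + 1) % 2 = s.2 % 2
      · exact ⟨1, one_ne_zero, h⟩
      · exact ⟨2, two_ne_zero, by omega⟩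
    obtain ⟨Z, hZ, hZp⟩ :=
      (hinf.sdiff (A.map Prod.snd).flatten.toFinset.finite_toSet).exists_subset_card_eq p
    have hZ0 : ∀ i ∈ Z, η i = 0 ∧ i ∉ (A.map Prod.snd).flatten := fun i hi => by
      have := hZ hi
      exact ⟨this.1, fun h => this.2 (by simpa using h)⟩
    have htl : (O.take d).length = d := by rw [List.length_take]; omega
    have hη1 : ((O.take d).map η) = List.replicate d 1 := by
      rw [List.eq_replicate_iff]
      refine ⟨by simpa using htl, fun b hb => ?_⟩
      obtain ⟨i, hi, rfl⟩ := List.mem_map.1 hb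
      exact hη i (List.mem_of_mem_take hi)
    have hη0 : (Z.toList.map η).sum = 0 := by
      refine List.sum_eq_zero fun b hb => ?_
      obtain ⟨i, hi, rfl⟩ := List.mem_map.1 hb
      exact (hZ0 i (Finset.mem_toList.1 hi)).1
    have htd : ∀ i ∈ O.take d, i ∉ O.drop d := by
      intro i hi hi'
      have := hO
      rw [← List.take_append_drop d O, List.nodup_append] at this
      exact this.2.2 i hi i hi' rfl
    refine ⟨(s, O.take d ++ Z.toList) :: A, by simp [hA], ?_, ?_, ?_⟩
    · intro t ht
      rcases List.mem_cons.1 ht with rfl | ht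
      · refine ⟨by simp [hη1, hη0, hd], by simp [htl, hZp, hp], fun h => hp0 ?_⟩
        have := congrArg List.length h
        simp at this
        rw [← hZp, this.2, Finset.card_empty]
      · exact hAs t ht
    · simp only [List.map_cons, List.flatten_cons]
      refine List.Nodup.append (List.Nodup.append (hO.sublist (List.take_sublist _ _))
        Z.nodup_toList ?_) hAn ?_
      · intro i hi hi'
        have h1 := hη i (List.mem_of_mem_take hi)
        have h0 := (hZ0 i (Finset.mem_toList.1 hi')).1
        omega
      · intro i hi hi'
        rcases List.mem_append.1 hi with hi | hi
        · rcases hAO i hi' with h | h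
          · exact htd i hi h
          · have h1 := hη i (List.mem_of_mem_take hi)
            omega
        · exact (hZ0 i (Finset.mem_toList.1 hi)).2 hi'
    · intro i hi
      simp only [List.map_cons, List.flatten_cons, List.mem_append] at hi
      rcases hi with (hi | hi) | hi
      · exact Or.inl (List.mem_of_mem_take hi)
      · exact Or.inr (hZ0 i (Finset.mem_toList.1 hi)).1
      · exact (hAO i hi).imp_left List.mem_of_mem_drop

theorem bracketProd_add_central {V R : Type*} [Ring R] {y : V → R} (hy : ∀ v b, y v * b = b * y v)
    (z : V → R) : ∀ l : List V, bracketProd (fun v => y v + z v) l = bracketProd z l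
  | [] => rfl
  | [_] => rfl
  | a :: b :: l => by
    rw [bracketProd, bracketProd, bracketProd_add_central hy z l]
    congr 1
    simp only [Ring.lie_def, add_mul, mul_add]
    rw [hy a (y b), hy a (z b), ← hy b (z a)]
    abel

theorem bracketProd_of_anticomm {V R : Type*} [Ring R] {z : V → R}
    (hz : ∀ u v, z u * z v = -(z v * z u)) :
    ∀ l : List V, Even l.length → bracketProd z l = 2 ^ (l.length / 2) * (l.map z).prod
  | [], _ => by simp [bracketProd]
  | [_], h => by simp at h
  | a :: b :: l, h => by
    have h2 : (a :: b :: l).length / 2 = l.length / 2 + 1 := by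
      simp only [List.length_cons]; omega
    have hc : 2 ^ (l.length / 2) * (z a * z b) = z a * z b * 2 ^ (l.length / 2) := by
      exact_mod_cast (Nat.cast_commute (2 ^ (l.length / 2)) (z a * z b)).eq
    rw [bracketProd, bracketProd_of_anticomm hz l (by grind), h2, Ring.lie_def, hz b a, pow_succ',
      sub_neg_eq_add, ← two_mul, List.map_cons, List.map_cons, List.prod_cons, List.prod_cons,
      mul_assoc 2 (2 ^ _), ← mul_assoc (z a), ← mul_assoc (2 ^ _), hc]
    simp only [mul_assoc]

theorem prod_add_mul_of_mul_eq_zero {V R : Type*} [Ring R] {y z : V → R} {P : R}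
    (hy : ∀ v b, y v * b = b * y v) (hz : ∀ v, z v * P = 0) (l : List V) :
    (l.map fun v => y v + z v).prod * P = (l.map y).prod * P := by
  induction l with
  | nil => simp
  | cons v l ih =>
    have hc : ∀ l : List V, ∀ b, (l.map y).prod * b = b * (l.map y).prod := by
      intro l b
      induction l with
      | nil => simp
      | cons v l ih => rw [List.map_cons, List.prod_cons, mul_assoc, ih, ← mul_assoc, hy, mul_assoc]
    have h0 : z v * ((l.map y).prod * P) = 0 := by
      rw [hc, ← mul_assoc, hz, zero_mul]
    rw [List.map_cons, List.prod_cons, mul_assoc, ih, add_mul, h0, add_zero, List.map_cons,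
      List.prod_cons, mul_assoc]

theorem labelSum_eq_zero {V C : Type*} [DecidableEq V] [AddCommMonoid C] {A : List (V × C)} {v : V}
    (hv : v ∉ A.map Prod.fst) : labelSum A v = 0 := by
  refine List.sum_eq_zero fun c hc => ?_
  obtain ⟨s, hs, rfl⟩ := List.mem_map.1 hc
  rw [if_neg]
  rintro rfl
  exact hv (List.mem_map_of_mem hs)

theorem labelSum_eq_of_nodup {V C : Type*} [DecidableEq V] [AddCommMonoid C] {A : List (V × C)}
    (hA : (A.map Prod.fst).Nodup) {s : V × C} (hs : s ∈ A) : labelSum A s.1 = s.2 := by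
  induction A with
  | nil => simp at hs
  | cons t A ih =>
    rw [List.map_cons, List.nodup_cons] at hA
    have hL : labelSum (t :: A) s.1 = (if s.1 = t.1 then t.2 else 0) + labelSum A s.1 := by
      simp [labelSum]
    rw [hL]
    rcases List.mem_cons.1 hs with rfl | hs
    · rw [if_pos rfl, labelSum_eq_zero hA.1, add_zero]
    · rw [if_neg, zero_add, ih hA.2 hs]
      intro h
      exact hA.1 (h ▸ List.mem_map_of_mem hs)

/-- For a pair `p₀ = (a₀, J₀)`, substitute for the variable `v` the sum of an even word for each
occurrence of `v` in `a₀` and of an odd word if `v ∈ J₀`, all these words having disjoint supports.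
The normal element of `p₀` survives, and only few others do. -/
theorem exists_generic_substitution [CharZero F] {η : ℕ+ → ℤ}
    (h01 : ∀ i, η i = 0 ∨ η i = 1) (hinf : {i | η i = 0}.Infinite) (p₀ : Multiset Var × Finset Var)
    (hdeg₁ : ∀ v ∈ p₀.1, 0 ≤ v.deg) (hdeg₂ : ∀ v ∈ p₀.2, 0 ≤ v.deg) (heven : Even p₀.2.card)
    (S : Finset ℕ+)
    (hS : ∑ i ∈ S, η i = (p₀.1.toList.map Var.deg).sum + (p₀.2.toList.map Var.deg).sum) :
    ∃ x : Var → E F, (∀ v, x v ∈ gradingOf F η v.deg) ∧ normalElem x p₀ ≠ 0 ∧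
      ∀ p, normalElem x p ≠ 0 → p.2 ⊆ p₀.2 ∧ (p.2 = p₀.2 → p.1 ≤ p₀.1) := by
  classical
  obtain ⟨A, hA, hAs, hAn, -⟩ := exists_disjoint_words hinf
    (p₀.1.toList.map (fun v => (v, 0)) ++ p₀.2.toList.map (fun v => (v, 1)))
    (by
      intro s hs
      rcases List.mem_append.1 hs with hs | hs <;> obtain ⟨v, hv, rfl⟩ := List.mem_map.1 hs
      · exact hdeg₁ v (Multiset.mem_toList.1 hv)
      · exact hdeg₂ v (Finset.mem_toList.1 hv))
    (S.filter fun i => η i = 1).toList (Finset.nodup_toList _)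
    (fun i hi => (Finset.mem_filter.1 (Finset.mem_toList.1 hi)).2)
    (by
      rw [List.map_append, List.sum_append, List.map_map, List.map_map, Finset.length_toList]
      refine Eq.trans ?_ hS
      rw [Finset.card_filter, Nat.cast_sum]
      refine Finset.sum_congr rfl fun i _ => ?_
      rcases h01 i with h | h <;> simp [h])
  obtain ⟨A₁, A₂, rfl, hA₁, hA₂⟩ := List.map_eq_append_iff.1 hA
  have hs₁ : ∀ s ∈ A₁, (s.2.map η).sum = s.1.1.deg ∧ Even s.2.length ∧ s.2 ≠ [] := by
    intro s hs
    obtain ⟨v, -, hv⟩ := List.mem_map.1 (hA₁ ▸ List.mem_map_of_mem hs)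
    obtain ⟨h, h', h''⟩ := hAs s (List.mem_append_left _ hs)
    rw [← hv] at h'
    exact ⟨h, Nat.even_iff.2 h', h''⟩
  have hs₂ : ∀ s ∈ A₂, (s.2.map η).sum = s.1.1.deg ∧ Odd s.2.length := by
    intro s hs
    obtain ⟨v, -, hv⟩ := List.mem_map.1 (hA₂ ▸ List.mem_map_of_mem hs)
    obtain ⟨h, h', h''⟩ := hAs s (List.mem_append_right _ hs)
    rw [← hv] at h'
    exact ⟨h, Nat.odd_iff.2 h'⟩
  -- the even words are regarded as elements of the commutative ring given by the center
  let c : List ℕ+ → Subalgebra.center F (E F) := fun t =>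
    if h : Even t.length then ⟨eWord F t, eWord_mem_center h⟩ else 0
  have hc : ∀ s ∈ A₁, (c s.2 : E F) = eWord F s.2 := fun s hs => by
    simp only [c, dif_pos (hs₁ s hs).2.1]
  let B₁ : List (Var × Subalgebra.center F (E F)) := A₁.map fun s => (s.1.1, c s.2)
  let B₂ : List (Var × E F) := A₂.map fun s => (s.1.1, eWord F s.2)
  have hB₁ : B₁.map Prod.fst = p₀.1.toList := by
    have := congrArg (List.map Prod.fst) hA₁
    simpa [B₁, Function.comp_def] using this
  have hB₂ : B₂.map Prod.fst = p₀.2.toList := by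
    have := congrArg (List.map Prod.fst) hA₂
    simpa [B₂, Function.comp_def] using this
  let y : Var → E F := fun v => ((labelSum B₁ v : Subalgebra.center F (E F)) : E F)
  let z : Var → E F := labelSum B₂
  have hy : ∀ v b, y v * b = b * y v := fun v b =>
    (Subalgebra.mem_center_iff.1 (labelSum B₁ v).2 b).symm
  have hnd : (B₂.map Prod.fst).Nodup := hB₂ ▸ Finset.nodup_toList _
  have hz0 : ∀ v, v ∉ p₀.2 → z v = 0 := fun v hv =>
    labelSum_eq_zero (by rwa [hB₂, Finset.mem_toList])
  have hzw : ∀ v, v ∈ p₀.2 → ∃ s ∈ A₂, s.1.1 = v ∧ z v = eWord F s.2 := by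
    intro v hv
    rw [← Finset.mem_toList, ← hB₂, List.mem_map] at hv
    obtain ⟨_, ht, rfl⟩ := hv
    obtain ⟨s, hs, rfl⟩ := List.mem_map.1 ht
    exact ⟨s, hs, rfl, labelSum_eq_of_nodup hnd ht⟩
  have hzz : ∀ u v, z u * z v = -(z v * z u) := by
    intro u v
    by_cases hu : u ∈ p₀.2
    · by_cases hv : v ∈ p₀.2
      · obtain ⟨s, hs, -, hzu⟩ := hzw u hu
        obtain ⟨t, ht, -, hzv⟩ := hzw v hv
        rw [hzu, hzv, eWord_mul_eWord, ((hs₂ s hs).2.mul (hs₂ t ht).2).neg_one_pow, neg_one_mul]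
      · rw [hz0 v hv, mul_zero, zero_mul, neg_zero]
    · rw [hz0 u hu, mul_zero, zero_mul, neg_zero]
  -- the product of all odd words
  have hP : (p₀.2.toList.map z).prod = eWord F (A₂.map Prod.snd).flatten := by
    rw [eWord_flatten, ← hB₂, List.map_map, List.map_map, List.map_map]
    congr 1
    refine List.map_congr_left fun s hs => ?_
    exact labelSum_eq_of_nodup hnd (s := (s.1.1, eWord F s.2)) (List.mem_map_of_mem hs)
  have hzP : ∀ v, z v * (p₀.2.toList.map z).prod = 0 := by
    intro v
    by_cases hv : v ∈ p₀.2
    · obtain ⟨s, hs, -, hzv⟩ := hzw v hv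
      rw [hP, hzv, ← eWord_append]
      refine isSkew_eWord.eq_zero_of_not_nodup F fun h => ?_
      obtain ⟨i, hi⟩ := List.exists_mem_of_ne_nil s.2 (by
        rintro h0
        simpa [h0] using (hs₂ s hs).2)
      exact List.disjoint_of_nodup_append h hi
        (List.mem_flatten.2 ⟨s.2, List.mem_map_of_mem hs, hi⟩)
    · rw [hz0 v hv, zero_mul]
  have hsq : ∀ s ∈ B₁, s.2 * s.2 = 0 := by
    intro s hs
    obtain ⟨t, ht, rfl⟩ := List.mem_map.1 hs
    refine Subtype.ext ?_
    change (c t.2 : E F) * (c t.2 : E F) = 0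
    rw [hc t ht, ← eWord_append]
    refine isSkew_eWord.eq_zero_of_not_nodup F fun h => ?_
    obtain ⟨i, hi⟩ := List.exists_mem_of_ne_nil _ (hs₁ t ht).2.2
    exact List.disjoint_of_nodup_append h hi hi
  obtain ⟨hlab0, n, hn, hlab⟩ := prod_labelSum B₁ hsq
  rw [hB₁, Multiset.coe_toList] at hlab0 hlab
  have hyprod : ∀ a : Multiset Var, (a.toList.map y).prod = ((a.map (labelSum B₁)).prod : E F) := by
    intro a
    conv_rhs => rw [← Multiset.coe_toList a, Multiset.map_coe, Multiset.prod_coe]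
    rw [← Subalgebra.coe_val, map_list_prod, List.map_map]
    rfl
  have hmain : ∀ a : Multiset Var, normalElem (fun v => y v + z v) (a, p₀.2) =
      2 ^ (p₀.2.card / 2) *
        (((a.map (labelSum B₁)).prod : E F) * eWord F (A₂.map Prod.snd).flatten) := by
    intro a
    have h2 : ∀ b : E F, b * 2 ^ (p₀.2.card / 2) = 2 ^ (p₀.2.card / 2) * b := fun b => by
      exact_mod_cast (Nat.cast_commute (2 ^ (p₀.2.card / 2)) b).eq.symm
    rw [normalElem, bracketProd_add_central hy, bracketProd_of_anticomm hzz _ (by simpa using heven),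
      Finset.length_toList, ← mul_assoc, h2, mul_assoc, prod_add_mul_of_mul_eq_zero hy hzP, hyprod,
      hP]
  refine ⟨fun v => y v + z v, fun v => add_mem ?_ ?_, ?_, fun p hp => ⟨fun v hv => ?_, fun h => ?_⟩⟩
  · have hyv : y v = ((B₁.map fun s => if v = s.1 then (s.2 : E F) else 0)).sum := by
      change ((Subalgebra.center F (E F)).val) _ = _
      rw [labelSum, map_list_sum, List.map_map]
      congr 1
      refine List.map_congr_left fun s _ => ?_
      simp only [Function.comp_apply]
      split_ifs <;> simp
    rw [hyv]
    refine list_sum_mem fun b hb => ?_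
    obtain ⟨_, ht, rfl⟩ := List.mem_map.1 hb
    obtain ⟨s, hs, rfl⟩ := List.mem_map.1 ht
    split_ifs with h
    · rw [hc s hs, h, ← (hs₁ s hs).1]
      exact eWord_mem_gradingOf η _
    · exact zero_mem _
  · by_cases hv : v ∈ p₀.2
    · obtain ⟨s, hs, rfl, hzv⟩ := hzw v hv
      rw [hzv, ← (hs₂ s hs).1]
      exact eWord_mem_gradingOf η _
    · rw [hz0 v hv]
      exact zero_mem _
  · change normalElem _ (p₀.1, p₀.2) ≠ 0
    have hB : ((B₁.map Prod.snd).prod : E F) = eWord F (A₁.map Prod.snd).flatten := by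
      rw [eWord_flatten, ← Subalgebra.coe_val, map_list_prod, List.map_map, List.map_map,
        List.map_map]
      congr 1
      exact List.map_congr_left fun s hs => hc s hs
    have hcast : (2 : E F) ^ (p₀.2.card / 2) = algebraMap F (E F) (2 ^ (p₀.2.card / 2)) := by
      rw [map_pow, map_ofNat]
    rw [hmain, hlab, hcast, ← Algebra.smul_def, Subalgebra.coe_smul, hB, smul_mul_assoc,
      ← eWord_append, ← Nat.cast_smul_eq_nsmul F]
    refine smul_ne_zero (pow_ne_zero _ two_ne_zero)
      (smul_ne_zero (by exact_mod_cast hn) (eWord_ne_zero ?_))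
    simpa using hAn
  · by_contra hv'
    apply hp
    rw [normalElem, bracketProd_add_central hy, bracketProd_eq_zero z _
      ⟨v, Finset.mem_toList.2 hv, hz0 v hv'⟩, mul_zero]
  · by_contra hle
    apply hp
    change normalElem _ (p.1, p.2) = 0
    rw [h, hmain, hlab0 _ hle, ZeroMemClass.coe_zero, zero_mul, mul_zero]

/-! ### Generators of the ideal of graded identities -/

theorem gradingOf_eq_bot {η : ℕ+ → ℤ} {n : ℤ}
    (hn : ∀ S : Finset ℕ+, ∑ i ∈ S, η i ≠ n) : gradingOf F η n = ⊥ := by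
  rw [gradingOf, Submodule.span_eq_bot]
  rintro _ ⟨S, hS, -⟩
  exact absurd hS (hn S)

/-- The common form of both gradings: each generator has degree `0` or `1`, infinitely many of
them have degree `0`, and `D` is the set of degrees that do not occur. -/
theorem gradedIdentities_gradingOf [CharZero F] {η : ℕ+ → ℤ}
    (h01 : ∀ i, η i = 0 ∨ η i = 1) (hinf : {i | η i = 0}.Infinite) {D : Set ℤ}
    (hD : ∀ n, n ∈ D ↔ ∀ S : Finset ℕ+, ∑ i ∈ S, η i ≠ n) :
    gradedIdentities (gradingOf F η) = tIdealSpan (varsWithDegIn F D ∪ tripleCommutators F) := by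
  classical
  set I := tIdealSpan (varsWithDegIn F D ∪ tripleCommutators F) with hI
  have hIT : IsTIdeal I := isTIdeal_tIdealSpan _
  have hIS := subset_tIdealSpan (varsWithDegIn F D ∪ tripleCommutators F)
  have hle : I ≤ gradedIdentities (gradingOf F η) := by
    refine tIdealSpan_le (isTIdeal_gradedIdentities η) ?_
    rintro _ (⟨v, hv, rfl⟩ | ⟨i, j, k, rfl⟩) <;> rw [SetLike.mem_coe, mem_gradedIdentities] <;>
      intro a ha
    · have := ha v
      rw [gradingOf_eq_bot ((hD _).1 hv), Submodule.mem_bot] at this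
      rw [FreeAlgebra.lift_ι_apply, this]
    · have := lie_lie_eq_zero_of_mem_gradingOf η (ha (i, 1)) (ha (j, 2)) (ha (k, 3))
      simpa only [Ring.lie_def, map_sub, map_mul, FreeAlgebra.lift_ι_apply] using this
  refine le_antisymm (fun f hf => ?_) hle
  let π : FreeGr F →ₐ[F] I.ringCon.Quotient := I.ringCon.mkₐ (α := F)
  have hπ : ∀ f, π f = 0 ↔ f ∈ I := fun f => by
    rw [TwoSidedIdeal.mem_iff, ← RingCon.eq]; rfl
  have hπn : ∀ p, π (normalElem (X F) p) = normalElem (fun v => π (X F v)) p :=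
    fun p => map_normalElem π.toRingHom _ p
  have hnil := hIT.isLieNilpotent_quotient fun f hf => hIS (Or.inr hf)
  have hlift : FreeAlgebra.lift F (fun v => π (X F v)) f = π f := by
    have : FreeAlgebra.lift F (fun v => π (X F v)) = π := by
      apply FreeAlgebra.hom_ext
      funext v
      simp only [Function.comp_apply, FreeAlgebra.lift_ι_apply]
    rw [this]
  obtain ⟨c, hc⟩ := (Finsupp.mem_span_range_iff_exists_finsupp).1
    (hlift ▸ hnil.lift_mem_span (F := F) (fun v => π (X F v)) f)
  -- the terms that lie in `I` are dropped
  let c' := c.filter fun p => normalElem (X F) p ∉ I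
  have hc' : (c'.sum fun p r => r • normalElem (fun v => π (X F v)) p) = π f := by
    rw [← hc]
    refine Finsupp.sum_filter_index _ _ _ |>.trans ?_
    refine Finset.sum_subset ?_ ?_
    · rw [Finsupp.support_filter]; exact Finset.filter_subset _ _
    · intro p hp hp'
      rw [Finsupp.support_filter, Finset.mem_filter, not_and_not_right] at hp'
      rw [← hπn, (hπ _).2 (hp' hp), smul_zero]
  have hc'I : ∀ p ∈ c'.support, normalElem (X F) p ∉ I := fun p hp => by
    rw [Finsupp.support_filter] at hp
    exact (Finset.mem_filter.1 hp).2
  -- the remaining combination is a graded identity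
  let g : FreeGr F := c'.sum fun p r => r • normalElem (X F) p
  have hg : π g = π f := by
    rw [← hc']
    simp only [g, Finsupp.sum, map_sum]
    exact Finset.sum_congr rfl fun p _ => by rw [map_smul, hπn]
  have hgid : IsGradedIdentity (gradingOf F η) g := by
    rw [← mem_gradedIdentities]
    have : f - g ∈ I := by rw [← hπ, map_sub, hg, sub_self]
    simpa using sub_mem hf (hle this)
  rcases Finset.eq_empty_or_nonempty c'.support with h0 | hne
  · rw [← hπ, ← hc', Finsupp.sum, h0, Finset.sum_empty]
  exfalso
  obtain ⟨p₀, hp₀, hmin⟩ := Finset.exists_min_image c'.support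
    (fun p => toLex (p.2.card, Multiset.card p.1)) hne
  have hp₀I := hc'I p₀ hp₀
  have hvD : ∀ v : Var, π (X F v) ≠ 0 → 0 ≤ v.deg := by
    intro v hv
    by_contra hneg
    refine hv ((hπ _).2 (hIS (Or.inl ⟨v, (hD _).2 fun S hS => hneg ?_, rfl⟩)))
    rw [← hS]
    exact Finset.sum_nonneg fun i _ => by rcases h01 i with h | h <;> omega
  have hdeg₁ : ∀ v ∈ p₀.1, 0 ≤ v.deg := by
    refine fun v hv => hvD v fun h => hp₀I ((hπ _).1 ?_)
    rw [hπn, normalElem, List.prod_eq_zero, zero_mul]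
    exact List.mem_map.2 ⟨v, Multiset.mem_toList.2 hv, h⟩
  have hdeg₂ : ∀ v ∈ p₀.2, 0 ≤ v.deg := by
    refine fun v hv => hvD v fun h => hp₀I ((hπ _).1 ?_)
    rw [hπn, normalElem, bracketProd_eq_zero _ _ ⟨v, Finset.mem_toList.2 hv, h⟩, mul_zero]
  have heven : Even p₀.2.card := by
    by_contra h
    apply hp₀I
    rw [normalElem, bracketProd_eq_zero_of_odd _ _ (by simpa using h), mul_zero]
    exact zero_mem I
  obtain ⟨S, hS⟩ : ∃ S : Finset ℕ+, ∑ i ∈ S, η i =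
      (p₀.1.toList.map Var.deg).sum + (p₀.2.toList.map Var.deg).sum := by
    by_contra! h
    -- otherwise the normal element is a substitution instance of a variable in `I`
    let v : Var := ((p₀.1.toList.map Var.deg).sum + (p₀.2.toList.map Var.deg).sum, 0)
    have hv : X F v ∈ I := hIS (Or.inl ⟨v, (hD v.deg).2 h, rfl⟩)
    exact hp₀I (hIT.mem_of_mem_freeComponent hv (normalElem_mem_freeComponent p₀))
  -- by minimality of `p₀`, only its own term survives a generic substitution
  obtain ⟨x, hx, hx₀, hxp⟩ := exists_generic_substitution (F := F) h01 hinf p₀ hdeg₁ hdeg₂ heven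
    S hS
  have hev := hgid x hx
  have hxn : ∀ p, FreeAlgebra.lift F x (normalElem (X F) p) = normalElem x p := fun p => by
    have := map_normalElem (FreeAlgebra.lift F x).toRingHom (X F) p
    simpa using this
  simp only [g, Finsupp.sum, map_sum] at hev
  rw [Finset.sum_eq_single p₀] at hev
  · rw [map_smul, hxn] at hev
    exact smul_ne_zero (Finsupp.mem_support_iff.1 hp₀) hx₀ hev
  · intro p hp hne
    rw [map_smul, hxn]
    by_contra hnz
    obtain ⟨hsub, hle'⟩ := hxp p (right_ne_zero_of_smul hnz)
    have hlex := hmin p hp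
    rw [Prod.Lex.toLex_le_toLex] at hlex
    have hcard := Finset.card_le_card hsub
    have h2 : p.2 = p₀.2 := Finset.eq_of_subset_of_card_le hsub (by
      rcases hlex with h | h
      · exact h.le
      · exact h.1.le)
    have h1 : p.1 = p₀.1 := Multiset.eq_of_le_of_card_le (hle' h2) (by
      rcases hlex with h | h
      · rw [h2] at h; exact absurd h (lt_irrefl _)
      · exact h.2)
    exact hne (Prod.ext h1 h2)
  · exact fun h => absurd hp₀ h

end GrassmannZ

theorem mainTheorem3 (F : Type*) [Field F] [CharZero F] :
    GrassmannZ.gradedIdentities (GrassmannZ.gradingInfty F) =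
      GrassmannZ.tIdealSpan
        (GrassmannZ.varsWithDegIn F {n : ℤ | n < 0} ∪ GrassmannZ.tripleCommutators F) ∧
    ∀ k : ℕ, 0 < k →
      GrassmannZ.gradedIdentities (GrassmannZ.gradingStar F k) =
        GrassmannZ.tIdealSpan
          (GrassmannZ.varsWithDegIn F {n : ℤ | n ∉ Set.Icc (0 : ℤ) (k : ℤ)} ∪
            GrassmannZ.tripleCommutators F) := by
  refine ⟨GrassmannZ.gradedIdentities_gradingOf (fun i => ?_) ?_ fun n => ?_, fun k _ =>
    GrassmannZ.gradedIdentities_gradingOf (fun i => ?_) ?_ fun n => ?_⟩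
  · split_ifs <;> simp
  · refine Set.infinite_of_injective_forall_mem (f := fun m : ℕ => (⟨2 * m + 2, by omega⟩ : ℕ+))
      (fun a b h => ?_) fun m => ?_
    · have := congrArg PNat.val h
      simp at this
      omega
    · exact if_pos (show Even (2 * m + 2) by grind)
  · rw [Set.mem_ofPred_eq]
    constructor
    · rintro hn S rfl
      exact hn.not_ge (Finset.sum_nonneg fun i _ => by split_ifs <;> simp)
    · intro h
      by_contra hn
      -- the first `n` odd indices
      refine h ((Finset.range n.toNat).map ⟨fun m : ℕ => (⟨2 * m + 1, by omega⟩ : ℕ+),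
        fun a b hab => ?_⟩) ?_
      · have := congrArg PNat.val hab
        simp at this
        omega
      · rw [Finset.sum_map, Finset.sum_congr rfl (g := fun _ => (1 : ℤ)) fun m _ => ?_]
        · simp; omega
        · exact if_neg (show ¬ Even (2 * m + 1) by grind)
  · split_ifs <;> simp
  · refine Set.infinite_of_injective_forall_mem (f := fun m : ℕ => (⟨k + m + 1, by omega⟩ : ℕ+))
      (fun a b h => ?_) fun m => ?_
    · have := congrArg PNat.val h
      simp at this
      omega
    · exact if_neg (show ¬ k + m + 1 ≤ k by omega)
  · rw [Set.mem_ofPred_eq]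
    constructor
    · rintro hn S rfl
      refine hn ⟨Finset.sum_nonneg fun i _ => by split_ifs <;> simp, ?_⟩
      rw [← Finset.sum_filter, Finset.sum_const, nsmul_eq_mul, mul_one, Nat.cast_le]
      have : ((S.filter fun i : ℕ+ => (i : ℕ) ≤ k).map ⟨PNat.val, PNat.coe_injective⟩) ⊆
          Finset.Icc 1 k := by
        intro m hm
        obtain ⟨i, hi, rfl⟩ := Finset.mem_map.1 hm
        exact Finset.mem_Icc.2 ⟨i.pos, (Finset.mem_filter.1 hi).2⟩
      simpa using Finset.card_le_card this
    · intro h hn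
      -- the first `n` indices
      refine h ((Finset.range n.toNat).map ⟨fun m : ℕ => (⟨m + 1, by omega⟩ : ℕ+),
        fun a b hab => ?_⟩) ?_
      · have := congrArg PNat.val hab
        simp at this
        omega
      · rw [Finset.sum_map, Finset.sum_congr rfl (g := fun _ => (1 : ℤ)) fun m hm => ?_]
        · simp [hn.1]
        · have h1 := hn.2
          have : m + 1 ≤ k := by have := Finset.mem_range.1 hm; omega
          exact if_pos this
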